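/- Let $a=(a(1),a(2))$ be a random vector taking values (almost surely) in $\mathbb{R}_+^2\setminus\{0\}$, let $\Delta_2=\{x\in\mathbb{R}_+^2 : x(1)+x(2)=1\}$, and let $f(x)=\mathbb{E}\left[-\log\langle a,x\rangle\right]\in[-\infty,+\infty]$, where $-\log u=+\infty$ for $u\le 0$. Let $x^\star$ be a minimizer of $f$ over $\Delta_2$ such that $f(x^\star)$ is finite (that is, $\log\langle a,x^\star\rangle$ is integrable) and $x^\star$ lies in the relative interior of $\Delta_2$. Assume that $a(1)/a(2)\in[0,+\infty]$ is not almost surely constant. Then $f$ is finite and has first-order partial derivatives in a neighbourhood of $x^\star$, its second-order partial derivatives at $x^\star$ exist, and $$L:=\max_{i\neq j}\nabla^2_{ij}f(x^\star)=\nabla^2_{12}f(x^\star)<1 .$$ Moreover, let $S(x):=x\odot(-\nabla f(x))$, where $\odot$ is the entrywise product (with $S(x)(i):=0$ if $x(i)=0$ or $f(x)=+\infty$), let $x_1\in\Delta_2$, and let $x_{t+1}=S(x_t)$ for all $t\ge 1$. Then for every $L'\in(L,1)$ there exists $T\in\mathbb{N}$ such that $$d_{\mathrm H}(x_{t+1},x^\star)\le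 L'\cdot d_{\mathrm H}(x_t,x^\star)\qquad\text{for all } t\ge T,$$ where $d_{\mathrm H}(x,y)=\log\left(\max_i\frac{x(i)}{y(i)}\cdot\max_i\frac{y(i)}{x(i)}\right)$ is Hilbert's projective metric, with $d_{\mathrm H}(x,y)=+\infty$ if $x,y\in\mathbb{R}_+^2$ have different supports. -/

import Mathlib

open Filter Topology MeasureTheory
open scoped ENNReal

noncomputable section

namespace LogOptimal

/-- Expectation of an extended-real random variable: the expectation of its positive part
minus the expectation of its negative part. -/
def expectation {Ω : Type*} [MeasurableSpace Ω] (P : Measure Ω) (X : Ω → EReal) : EReal :=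
  ((∫⁻ ω, (X ω).toENNReal ∂P : ℝ≥0∞) : EReal) - ((∫⁻ ω, (-X ω).toENNReal ∂P : ℝ≥0∞) : EReal)

/-- The function `u ↦ -log u`, with value `+∞` for `u ≤ 0`. -/
def negLog (u : ℝ) : EReal := -ENNReal.log (ENNReal.ofReal u)

/-- The objective `f(x) = 𝔼[-log ⟨a, x⟩]`, with values in the extended reals. -/
def objective {Ω : Type*} [MeasurableSpace Ω] (P : Measure Ω) {d : ℕ} (a : Ω → Fin d → ℝ)
    (x : Fin d → ℝ) : EReal :=
  expectation P fun ω => negLog (∑ i, a ω i * x i)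

/-- The `i`-th partial derivative of `g` at `x`. -/
def partialDeriv {d : ℕ} (i : Fin d) (g : (Fin d → ℝ) → ℝ) (x : Fin d → ℝ) : ℝ :=
  lineDeriv ℝ g x (Pi.single i 1)

/-- The objective as a real function; it is only meaningful where the objective is finite. -/
def realObjective {Ω : Type*} [MeasurableSpace Ω] (P : Measure Ω) {d : ℕ} (a : Ω → Fin d → ℝ)
    (x : Fin d → ℝ) : ℝ :=
  (objective P a x).toReal

/-- The entry `∇²ᵢⱼ f(x)` of the Hessian of the objective. -/
def hessian {Ω : Type*} [MeasurableSpace Ω] (P : Measure Ω) {d : ℕ} (a : Ω → Fin d → ℝ)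
    (x : Fin d → ℝ) (i j : Fin d) : ℝ :=
  partialDeriv i (partialDeriv j (realObjective P a)) x

/-- `L = max_{i ≠ j} ∇²ᵢⱼ f(x)`: the supremum of a finite family, nonempty for `d ≥ 2`. -/
def maxOffDiagHessian {Ω : Type*} [MeasurableSpace Ω] (P : Measure Ω) {d : ℕ}
    (a : Ω → Fin d → ℝ) (x : Fin d → ℝ) : ℝ :=
  ⨆ p : {p : Fin d × Fin d // p.1 ≠ p.2}, hessian P a x p.1.1 p.1.2

/-- The operator `S(x) = x ⊙ (-∇f(x))`. -/
def fixedPointOperator {Ω : Type*} [MeasurableSpace Ω] (P : Measure Ω) {d : ℕ}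
    (a : Ω → Fin d → ℝ) (x : Fin d → ℝ) : Fin d → ℝ :=
  fun i => x i * (-partialDeriv i (realObjective P a) x)

/-- `M(x/y) = max_i x(i)/y(i)` for `x, y` in the nonnegative orthant, where `0/0 = 0` and
`c/0 = ∞` for `c > 0`. This is the least `β ∈ [0, ∞]` with `x ≤ β y`. -/
def maxRatio {d : ℕ} (x y : Fin d → ℝ) : ℝ≥0∞ :=
  ⨆ i, ENNReal.ofReal (x i) / ENNReal.ofReal (y i)

open scoped Classical in
/-- Hilbert's projective metric `d_H(x, y) = log (M(x/y) M(y/x))` on the nonnegative orthant;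
it is `+∞` when `x` and `y` are not comparable, that is, have different supports. -/
def hilbertMetric {d : ℕ} (x y : Fin d → ℝ) : EReal :=
  if maxRatio x y ≠ ∞ ∧ maxRatio y x ≠ ∞ then
    ((Real.log (maxRatio x y * maxRatio y x).toReal : ℝ) : EReal)
  else ⊤

end LogOptimal

end

/-!
Write `q(u) = 𝔼[a(0) / ⟨a, x⟩]` and `r(u) = 𝔼[a(1) / ⟨a, x⟩]` at the point `x = (u, 1 - u)` of the
open segment; these are minus the partial derivatives of the objective, and `u q + (1 - u) r = 1`.
On the positive orthant `log ⟨a, x⟩` changes by a bounded amount from one point to another, and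
`a(i) / ⟨a, x⟩ ≤ 1 / x(i)`, so that finiteness of the objective at one interior point makes it
finite there and lets all derivatives be taken under the expectation
(`hasLineDerivAt_realObjective`, `hasLineDerivAt_partialDeriv`).

In the coordinate `u` the operator `S` is the nondecreasing map `g(u) = u q(u)`, whose derivative is
`𝔼[a(0) a(1) / ⟨a, x⟩²]`, the mixed second derivative of the objective
(`hasDerivAt_segmentMap`). At the minimizer `c` optimality gives `q(c) = r(c) = 1`. Two identities
then carry the proof, both with a factor `𝔼[(a(0) - a(1))² / (⟨a, x⟩ ⟨a, y⟩)]`, positive because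
`a(0) = a(1)` almost surely would make the ratio constant:

* `g(u) - u` is `u (1 - u) (c - u)` times that factor (`segmentMap_eq`), so the nondecreasing
  continuous map `g` moves every point strictly towards `c`, and its iterates converge to `c`
  (`tendsto_iterate`);
* `1 - L` is `c (1 - c)` times that factor (`one_sub_integral_mul_div_sq`), so `L < 1`.

On the open segment Hilbert's metric is the distance of the log-odds
(`hilbertMetric_eq_abs_logOdds`), and `g` has the same derivative `L` at its fixed point `c` in the
log-odds coordinate. As the iterates eventually stay in any neighbourhood of `c`, the ratio of successive
distances is eventually at most any `L' > L`. If a coordinate of the starting point vanishes, it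
stays zero and both distances are infinite.
-/

namespace LogOptimal

/-! ### Pointwise estimates on the positive orthant -/

section Pointwise

variable {d : ℕ} {w x y : Fin d → ℝ}

lemma mul_le_dotProduct (hw : ∀ i, 0 ≤ w i) (hx : ∀ i, 0 < x i) (i : Fin d) :
    w i * x i ≤ w ⬝ᵥ x :=
  Finset.single_le_sum (f := fun j => w j * x j)
    (fun j _ => mul_nonneg (hw j) (hx j).le) (Finset.mem_univ i)

lemma dotProduct_pos_of_ne_zero (hw : ∀ i, 0 ≤ w i) (hw0 : w ≠ 0) (hx : ∀ i, 0 < x i) :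
    0 < w ⬝ᵥ x := by
  obtain ⟨i, hi⟩ := Function.ne_iff.1 hw0
  exact (mul_pos ((hw i).lt_of_ne' hi) (hx i)).trans_le (mul_le_dotProduct hw hx i)

lemma div_dotProduct_le (hw : ∀ i, 0 ≤ w i) (hw0 : w ≠ 0) (hx : ∀ i, 0 < x i) (i : Fin d) :
    w i / (w ⬝ᵥ x) ≤ 1 / x i := by
  rw [div_le_div_iff₀ (dotProduct_pos_of_ne_zero hw hw0 hx) (hx i), one_mul]
  exact mul_le_dotProduct hw hx i

lemma abs_div_dotProduct_le (hw : ∀ i, 0 ≤ w i) (hw0 : w ≠ 0) (hx : ∀ i, 0 < x i) (i : Fin d) :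
    |w i / (w ⬝ᵥ x)| ≤ 1 / x i := by
  rw [abs_of_nonneg (div_nonneg (hw i) (dotProduct_pos_of_ne_zero hw hw0 hx).le)]
  exact div_dotProduct_le hw hw0 hx i

lemma abs_dotProduct_div_le (hw : ∀ i, 0 ≤ w i) (hw0 : w ≠ 0) (hx : ∀ i, 0 < x i)
    (v : Fin d → ℝ) : |(w ⬝ᵥ v) / (w ⬝ᵥ x)| ≤ ∑ i, |v i| / x i := by
  rw [dotProduct, Finset.sum_div]
  refine (Finset.abs_sum_le_sum_abs _ _).trans (Finset.sum_le_sum fun i _ => ?_)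
  rw [mul_div_right_comm, abs_mul, mul_comm, div_eq_mul_one_div |v i|]
  exact mul_le_mul_of_nonneg_left (abs_div_dotProduct_le hw hw0 hx i) (abs_nonneg _)

lemma log_dotProduct_sub_le (hw : ∀ i, 0 ≤ w i) (hw0 : w ≠ 0) (hx : ∀ i, 0 < x i)
    (hy : ∀ i, 0 < y i) :
    Real.log (w ⬝ᵥ y) - Real.log (w ⬝ᵥ x) ≤ ∑ i, y i / x i := by
  have hDx := dotProduct_pos_of_ne_zero hw hw0 hx
  have hDy := dotProduct_pos_of_ne_zero hw hw0 hy
  have h := abs_dotProduct_div_le hw hw0 hx y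
  rw [abs_of_pos (div_pos hDy hDx)] at h
  simp only [abs_of_pos (hy _)] at h
  rw [← Real.log_div hDy.ne' hDx.ne']
  exact (Real.log_le_self (div_pos hDy hDx).le).trans h

end Pointwise

/-! ### The objective as a Bochner integral -/

section Objective

variable {Ω : Type*} [MeasurableSpace Ω] {P : Measure Ω} {d : ℕ} {a : Ω → Fin d → ℝ}
  {x y : Fin d → ℝ}

lemma measurable_dotProduct (ha : Measurable a) (x : Fin d → ℝ) :
    Measurable fun ω => a ω ⬝ᵥ x :=
  Finset.measurable_sum _ fun i _ => ((measurable_pi_apply i).comp ha).mul_const _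

lemma negLog_of_pos {u : ℝ} (hu : 0 < u) : negLog u = ((-Real.log u : ℝ) : EReal) := by
  rw [negLog, ENNReal.log_ofReal_of_pos hu, EReal.coe_neg]

lemma ae_negLog_eq (ha_val : ∀ᵐ ω ∂P, (∀ i, 0 ≤ a ω i) ∧ a ω ≠ 0) (hx : ∀ i, 0 < x i) :
    ∀ᵐ ω ∂P, negLog (∑ i, a ω i * x i) = ((-Real.log (a ω ⬝ᵥ x) : ℝ) : EReal) := by
  filter_upwards [ha_val] with ω hω
  exact negLog_of_pos (dotProduct_pos_of_ne_zero hω.1 hω.2 hx)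

lemma objective_eq_sub (ha_val : ∀ᵐ ω ∂P, (∀ i, 0 ≤ a ω i) ∧ a ω ≠ 0) (hx : ∀ i, 0 < x i) :
    objective P a x =
      ((∫⁻ ω, ENNReal.ofReal (-Real.log (a ω ⬝ᵥ x)) ∂P : ℝ≥0∞) : EReal) -
        ((∫⁻ ω, ENNReal.ofReal (Real.log (a ω ⬝ᵥ x)) ∂P : ℝ≥0∞) : EReal) := by
  have h := ae_negLog_eq ha_val hx
  have h1 : ∫⁻ ω, (negLog (∑ i, a ω i * x i)).toENNReal ∂P =
      ∫⁻ ω, ENNReal.ofReal (-Real.log (a ω ⬝ᵥ x)) ∂P :=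
    lintegral_congr_ae (h.mono fun ω hω => by simp only [hω, EReal.real_coe_toENNReal])
  have h2 : ∫⁻ ω, (-negLog (∑ i, a ω i * x i)).toENNReal ∂P =
      ∫⁻ ω, ENNReal.ofReal (Real.log (a ω ⬝ᵥ x)) ∂P :=
    lintegral_congr_ae (h.mono fun ω hω => by
      simp only [hω, ← EReal.coe_neg, EReal.real_coe_toENNReal, neg_neg])
  rw [objective, expectation, h1, h2]

/-- Finiteness of the difference of the integrals of the two parts forces both to be finite. -/
lemma integrable_log_of_objective_finite (ha : Measurable a)
    (ha_val : ∀ᵐ ω ∂P, (∀ i, 0 ≤ a ω i) ∧ a ω ≠ 0) (hx : ∀ i, 0 < x i)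
    (hfin : objective P a x ≠ ⊤ ∧ objective P a x ≠ ⊥) :
    Integrable (fun ω => Real.log (a ω ⬝ᵥ x)) P := by
  rw [objective_eq_sub ha_val hx] at hfin
  set A := ∫⁻ ω, ENNReal.ofReal (-Real.log (a ω ⬝ᵥ x)) ∂P with hA
  set B := ∫⁻ ω, ENNReal.ofReal (Real.log (a ω ⬝ᵥ x)) ∂P with hB
  have hBt : B ≠ ⊤ := by
    intro h
    exact hfin.2 (by rw [h, EReal.coe_ennreal_top, EReal.sub_top])
  have hAt : A ≠ ⊤ := by
    intro h
    refine hfin.1 ?_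
    rw [h, EReal.coe_ennreal_top, ← EReal.coe_ennreal_toReal hBt]
    exact EReal.top_sub_coe _
  have hmeas : Measurable fun ω => Real.log (a ω ⬝ᵥ x) :=
    Real.measurable_log.comp (measurable_dotProduct ha x)
  have key : ∀ r : ℝ, ‖r‖ₑ = ENNReal.ofReal r + ENNReal.ofReal (-r) := by
    intro r
    rw [Real.enorm_eq_ofReal_abs]
    rcases le_total 0 r with h | h
    · rw [abs_of_nonneg h, ENNReal.ofReal_of_nonpos (neg_nonpos.2 h), add_zero]
    · rw [abs_of_nonpos h, ENNReal.ofReal_of_nonpos h, zero_add]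
  refine ⟨hmeas.aestronglyMeasurable, ?_⟩
  rw [hasFiniteIntegral_iff_enorm]
  simp only [key]
  rw [lintegral_add_left hmeas.ennreal_ofReal]
  exact ENNReal.add_lt_top.2 ⟨hBt.lt_top, hAt.lt_top⟩

lemma objective_eq_integral (ha_val : ∀ᵐ ω ∂P, (∀ i, 0 ≤ a ω i) ∧ a ω ≠ 0)
    (hx : ∀ i, 0 < x i) (hint : Integrable (fun ω => Real.log (a ω ⬝ᵥ x)) P) :
    objective P a x = ((∫ ω, -Real.log (a ω ⬝ᵥ x) ∂P : ℝ) : EReal) := by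
  rw [objective_eq_sub ha_val hx, integral_eq_lintegral_pos_part_sub_lintegral_neg_part
    (f := fun ω => -Real.log (a ω ⬝ᵥ x)) hint.neg, EReal.coe_sub]
  have h1 : (∫⁻ ω, ENNReal.ofReal (-Real.log (a ω ⬝ᵥ x)) ∂P) ≠ ⊤ :=
    (hint.neg.lintegral_lt_top).ne
  have h2 : (∫⁻ ω, ENNReal.ofReal (Real.log (a ω ⬝ᵥ x)) ∂P) ≠ ⊤ :=
    hint.lintegral_lt_top.ne
  simp only [neg_neg]
  rw [EReal.coe_ennreal_toReal h1, EReal.coe_ennreal_toReal h2]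

lemma realObjective_eq_integral (ha_val : ∀ᵐ ω ∂P, (∀ i, 0 ≤ a ω i) ∧ a ω ≠ 0)
    (hx : ∀ i, 0 < x i) (hint : Integrable (fun ω => Real.log (a ω ⬝ᵥ x)) P) :
    realObjective P a x = ∫ ω, -Real.log (a ω ⬝ᵥ x) ∂P := by
  rw [realObjective, objective_eq_integral ha_val hx hint, EReal.toReal_coe]

/-- On the positive orthant, `log ⟨a, y⟩` and `log ⟨a, x⟩` differ by a bounded amount, so that
finiteness at one point gives finiteness everywhere. -/
lemma integrable_log_of_integrable_log [IsFiniteMeasure P] (ha : Measurable a)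
    (ha_val : ∀ᵐ ω ∂P, (∀ i, 0 ≤ a ω i) ∧ a ω ≠ 0) (hx : ∀ i, 0 < x i)
    (hint : Integrable (fun ω => Real.log (a ω ⬝ᵥ x)) P) (hy : ∀ i, 0 < y i) :
    Integrable (fun ω => Real.log (a ω ⬝ᵥ y)) P := by
  have hm : ∀ z, AEStronglyMeasurable (fun ω => Real.log (a ω ⬝ᵥ z)) P := fun z =>
    (Real.measurable_log.comp (measurable_dotProduct ha z)).aestronglyMeasurable
  have hdiff : Integrable (fun ω => Real.log (a ω ⬝ᵥ y) - Real.log (a ω ⬝ᵥ x)) P := by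
    refine Integrable.of_bound ((hm y).sub (hm x)) (max (∑ i, y i / x i) (∑ i, x i / y i)) ?_
    filter_upwards [ha_val] with ω hω
    have h1 := log_dotProduct_sub_le hω.1 hω.2 hx hy
    have h2 := log_dotProduct_sub_le hω.1 hω.2 hy hx
    rw [Real.norm_eq_abs]
    refine abs_le'.2 ⟨h1.trans (le_max_left _ _), ?_⟩
    rw [neg_sub]
    exact h2.trans (le_max_right _ _)
  exact (hdiff.add hint).congr (ae_of_all _ fun ω => sub_add_cancel _ _)

end Objective

/-! ### Differentiation under the expectation -/

section Derivatives

variable {Ω : Type*} [MeasurableSpace Ω] {P : Measure Ω} [IsFiniteMeasure P] {d : ℕ}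
  {a : Ω → Fin d → ℝ} {x : Fin d → ℝ}

lemma eventually_pos (hx : ∀ i, 0 < x i) : ∀ᶠ y in 𝓝 x, ∀ i, 0 < y i :=
  eventually_all.2 fun i =>
    (continuous_apply i).continuousAt.eventually (lt_mem_nhds (hx i))

lemma eventually_half_lt_line (hx : ∀ i, 0 < x i) (v : Fin d → ℝ) :
    ∀ᶠ t : ℝ in 𝓝 0, ∀ i, x i / 2 < (x + t • v) i := by
  refine eventually_all.2 fun i => ?_
  have hc : ContinuousAt (fun t : ℝ => (x + t • v) i) 0 := by fun_prop
  refine hc.eventually (lt_mem_nhds ?_)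
  simpa using hx i

lemma tendsto_line (x v : Fin d → ℝ) : Tendsto (fun t : ℝ => x + t • v) (𝓝 0) (𝓝 x) := by
  have hc : ContinuousAt (fun t : ℝ => x + t • v) 0 := by fun_prop
  simpa [ContinuousAt] using hc

lemma hasDerivAt_dotProduct_line (w x v : Fin d → ℝ) (t : ℝ) :
    HasDerivAt (fun s : ℝ => w ⬝ᵥ (x + s • v)) (w ⬝ᵥ v) t := by
  simp only [dotProduct_add, dotProduct_smul, smul_eq_mul]
  simpa using ((hasDerivAt_id t).mul_const (w ⬝ᵥ v)).const_add (w ⬝ᵥ x)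

lemma integrable_div_dotProduct (ha : Measurable a)
    (ha_val : ∀ᵐ ω ∂P, (∀ i, 0 ≤ a ω i) ∧ a ω ≠ 0) (hx : ∀ i, 0 < x i) (j : Fin d) :
    Integrable (fun ω => a ω j / (a ω ⬝ᵥ x)) P := by
  refine Integrable.of_bound
    (((measurable_pi_apply j).comp ha).div (measurable_dotProduct ha x)).aestronglyMeasurable
    (1 / x j) ?_
  filter_upwards [ha_val] with ω hω
  exact abs_div_dotProduct_le hω.1 hω.2 hx j

/-- The directional derivatives of the objective on the positive orthant. -/
lemma hasLineDerivAt_realObjective (ha : Measurable a)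
    (ha_val : ∀ᵐ ω ∂P, (∀ i, 0 ≤ a ω i) ∧ a ω ≠ 0) (hx : ∀ i, 0 < x i)
    (hint : Integrable (fun ω => Real.log (a ω ⬝ᵥ x)) P) (v : Fin d → ℝ) :
    HasLineDerivAt ℝ (realObjective P a) (-∫ ω, (a ω ⬝ᵥ v) / (a ω ⬝ᵥ x) ∂P) x v := by
  have hs := eventually_half_lt_line hx v
  have hpos : ∀ t : ℝ, (∀ i, x i / 2 < (x + t • v) i) → ∀ i, 0 < (x + t • v) i :=
    fun t ht i => (half_pos (hx i)).trans (ht i)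
  have hm := measurable_dotProduct ha
  have key := (hasDerivAt_integral_of_dominated_loc_of_deriv_le (μ := P) (x₀ := (0 : ℝ))
    (F := fun t ω => Real.log (a ω ⬝ᵥ (x + t • v)))
    (F' := fun t ω => (a ω ⬝ᵥ v) / (a ω ⬝ᵥ (x + t • v)))
    (bound := fun _ => ∑ i, |v i| / (x i / 2)) hs
    (Eventually.of_forall fun t => (Real.measurable_log.comp (hm _)).aestronglyMeasurable)
    (by simpa using hint) ((hm v).div (hm _)).aestronglyMeasurable
    (by
      filter_upwards [ha_val] with ω hω t ht
      refine (abs_dotProduct_div_le hω.1 hω.2 (hpos t ht) v).trans ?_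
      exact Finset.sum_le_sum fun i _ =>
        div_le_div_of_nonneg_left (abs_nonneg _) (half_pos (hx i)) (ht i).le)
    (integrable_const _)
    (by
      filter_upwards [ha_val] with ω hω t ht
      exact (hasDerivAt_dotProduct_line (a ω) x v t).log
        (dotProduct_pos_of_ne_zero hω.1 hω.2 (hpos t ht)).ne')).2
  have key' := key.fun_neg
  simp only [zero_smul, add_zero] at key'
  refine key'.congr_of_eventuallyEq ?_
  filter_upwards [hs] with t ht
  rw [realObjective_eq_integral ha_val (hpos t ht)
    (integrable_log_of_integrable_log ha ha_val hx hint (hpos t ht)), integral_neg]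

/-- The directional derivatives of the map `x ↦ 𝔼[a(j) / ⟨a, x⟩]`, the negative of the `j`-th
partial derivative of the objective. -/
lemma hasLineDerivAt_integral_div (ha : Measurable a)
    (ha_val : ∀ᵐ ω ∂P, (∀ i, 0 ≤ a ω i) ∧ a ω ≠ 0) (hx : ∀ i, 0 < x i) (j : Fin d)
    (v : Fin d → ℝ) :
    Integrable (fun ω => a ω j * (a ω ⬝ᵥ v) / (a ω ⬝ᵥ x) ^ 2) P ∧
    HasLineDerivAt ℝ (fun y => ∫ ω, a ω j / (a ω ⬝ᵥ y) ∂P)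
      (-∫ ω, a ω j * (a ω ⬝ᵥ v) / (a ω ⬝ᵥ x) ^ 2 ∂P) x v := by
  have hs := eventually_half_lt_line hx v
  have hpos : ∀ t : ℝ, (∀ i, x i / 2 < (x + t • v) i) → ∀ i, 0 < (x + t • v) i :=
    fun t ht i => (half_pos (hx i)).trans (ht i)
  have hm := measurable_dotProduct ha
  have hj : Measurable fun ω => a ω j := (measurable_pi_apply j).comp ha
  have key := hasDerivAt_integral_of_dominated_loc_of_deriv_le (μ := P) (x₀ := (0 : ℝ))
    (F := fun t ω => a ω j / (a ω ⬝ᵥ (x + t • v)))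
    (F' := fun t ω => -(a ω j * (a ω ⬝ᵥ v) / (a ω ⬝ᵥ (x + t • v)) ^ 2))
    (bound := fun _ => 1 / (x j / 2) * ∑ i, |v i| / (x i / 2)) hs
    (Eventually.of_forall fun t => (hj.div (hm _)).aestronglyMeasurable)
    (by simpa using integrable_div_dotProduct ha ha_val hx j)
    (((hj.mul (hm v)).div ((hm _).pow_const 2)).neg).aestronglyMeasurable
    (by
      filter_upwards [ha_val] with ω hω t ht
      rw [norm_neg, sq, ← div_mul_div_comm, norm_mul]
      refine mul_le_mul ?_ ?_ (norm_nonneg _) (by have := hx j; positivity)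
      · refine (abs_div_dotProduct_le hω.1 hω.2 (hpos t ht) j).trans ?_
        exact one_div_le_one_div_of_le (half_pos (hx j)) (ht j).le
      · refine (abs_dotProduct_div_le hω.1 hω.2 (hpos t ht) v).trans ?_
        exact Finset.sum_le_sum fun i _ =>
          div_le_div_of_nonneg_left (abs_nonneg _) (half_pos (hx i)) (ht i).le)
    (integrable_const _)
    (by
      filter_upwards [ha_val] with ω hω t ht
      have := (hasDerivAt_const t (a ω j)).div (hasDerivAt_dotProduct_line (a ω) x v t)
        (dotProduct_pos_of_ne_zero hω.1 hω.2 (hpos t ht)).ne'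
      convert! this using 1
      ring)
  simp only [zero_smul, add_zero, integral_neg] at key
  exact ⟨by simpa using key.1.neg, key.2⟩

lemma partialDeriv_realObjective (ha : Measurable a)
    (ha_val : ∀ᵐ ω ∂P, (∀ i, 0 ≤ a ω i) ∧ a ω ≠ 0) (hx : ∀ i, 0 < x i)
    (hint : Integrable (fun ω => Real.log (a ω ⬝ᵥ x)) P) (j : Fin d) :
    partialDeriv j (realObjective P a) x = -∫ ω, a ω j / (a ω ⬝ᵥ x) ∂P := by
  rw [partialDeriv, (hasLineDerivAt_realObjective ha ha_val hx hint (Pi.single j 1)).lineDeriv]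
  simp only [dotProduct_single, mul_one]

lemma hasLineDerivAt_partialDeriv (ha : Measurable a)
    (ha_val : ∀ᵐ ω ∂P, (∀ i, 0 ≤ a ω i) ∧ a ω ≠ 0) (hx : ∀ i, 0 < x i)
    (hint : Integrable (fun ω => Real.log (a ω ⬝ᵥ x)) P) (i j : Fin d) :
    HasLineDerivAt ℝ (partialDeriv j (realObjective P a))
      (∫ ω, a ω j * a ω i / (a ω ⬝ᵥ x) ^ 2 ∂P) x (Pi.single i 1) := by
  have key := (hasLineDerivAt_integral_div ha ha_val hx j (Pi.single i 1)).2
  simp only [dotProduct_single, mul_one] at key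
  have key' := HasDerivAt.fun_neg key
  rw [neg_neg] at key'
  refine HasDerivAt.congr_of_eventuallyEq key' ?_
  filter_upwards [(tendsto_line x (Pi.single i 1)).eventually (eventually_pos hx)] with t ht
  exact partialDeriv_realObjective ha ha_val ht
    (integrable_log_of_integrable_log ha ha_val hx hint ht) j

lemma hessian_eq_integral (ha : Measurable a)
    (ha_val : ∀ᵐ ω ∂P, (∀ i, 0 ≤ a ω i) ∧ a ω ≠ 0) (hx : ∀ i, 0 < x i)
    (hint : Integrable (fun ω => Real.log (a ω ⬝ᵥ x)) P) (i j : Fin d) :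
    hessian P a x i j = ∫ ω, a ω j * a ω i / (a ω ⬝ᵥ x) ^ 2 ∂P :=
  (hasLineDerivAt_partialDeriv ha ha_val hx hint i j).lineDeriv

lemma fixedPointOperator_eq (ha : Measurable a)
    (ha_val : ∀ᵐ ω ∂P, (∀ i, 0 ≤ a ω i) ∧ a ω ≠ 0) (hx : ∀ i, 0 < x i)
    (hint : Integrable (fun ω => Real.log (a ω ⬝ᵥ x)) P) (i : Fin d) :
    fixedPointOperator P a x i = x i * ∫ ω, a ω i / (a ω ⬝ᵥ x) ∂P := by
  rw [fixedPointOperator, partialDeriv_realObjective ha ha_val hx hint, neg_neg]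

end Derivatives

/-! ### Monotone iterations on an interval -/

section Iteration

variable {g : ℝ → ℝ} {α β c : ℝ} {u : ℕ → ℝ}

lemma tendsto_iterate_of_le (hmono : MonotoneOn g (Set.Ioo α β))
    (hcont : ContinuousOn g (Set.Ioo α β)) (hc : c ∈ Set.Ioo α β) (hgc : g c = c)
    (hlt : ∀ v ∈ Set.Ioo α c, v < g v) (h0 : α < u 0) (h0c : u 0 ≤ c)
    (hu : ∀ n, u (n + 1) = g (u n)) :
    (∀ n, u n ∈ Set.Ioo α β) ∧ Tendsto u atTop (𝓝 c) := by
  have hle : ∀ v, α < v → v ≤ c → v ≤ g v := by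
    intro v h1 h2
    rcases h2.eq_or_lt with rfl | h2
    · exact hgc.ge
    · exact (hlt v ⟨h1, h2⟩).le
  have hmem : ∀ n, α < u n ∧ u n ≤ c := by
    intro n
    induction n with
    | zero => exact ⟨h0, h0c⟩
    | succ n ih =>
      rw [hu n]
      exact ⟨ih.1.trans_le (hle _ ih.1 ih.2),
        (hmono ⟨ih.1, ih.2.trans_lt hc.2⟩ hc ih.2).trans hgc.le⟩
  have hIoo : ∀ n, u n ∈ Set.Ioo α β := fun n => ⟨(hmem n).1, (hmem n).2.trans_lt hc.2⟩
  have humono : Monotone u := monotone_nat_of_le_succ fun n => by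
    rw [hu n]
    exact hle _ (hmem n).1 (hmem n).2
  have hbdd : BddAbove (Set.range u) := ⟨c, by rintro _ ⟨n, rfl⟩; exact (hmem n).2⟩
  have hlim := tendsto_atTop_ciSup humono hbdd
  set l := ⨆ n, u n with hl
  have hl0 : u 0 ≤ l := le_ciSup hbdd 0
  have hlc : l ≤ c := ciSup_le fun n => (hmem n).2
  have hlI : l ∈ Set.Ioo α β := ⟨h0.trans_le hl0, hlc.trans_lt hc.2⟩
  have hfix : g l = l := by
    have h1 : Tendsto (fun n => u (n + 1)) atTop (𝓝 l) := hlim.comp (tendsto_add_atTop_nat 1)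
    have h2 : Tendsto (fun n => g (u n)) atTop (𝓝 (g l)) :=
      (hcont.continuousAt (isOpen_Ioo.mem_nhds hlI)).tendsto.comp hlim
    simp only [hu] at h1
    exact tendsto_nhds_unique h2 h1
  have : l = c := by
    rcases hlc.eq_or_lt with h | h
    · exact h
    · exact absurd hfix (hlt l ⟨hlI.1, h⟩).ne'
  exact ⟨hIoo, this ▸ hlim⟩

/-- The iterates of a continuous nondecreasing map that moves every point strictly towards its fixed
point converge to that fixed point. -/
lemma tendsto_iterate (hmono : MonotoneOn g (Set.Ioo α β))
    (hcont : ContinuousOn g (Set.Ioo α β)) (hc : c ∈ Set.Ioo α β) (hgc : g c = c)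
    (hlt : ∀ v ∈ Set.Ioo α c, v < g v) (hgt : ∀ v ∈ Set.Ioo c β, g v < v)
    (h0 : u 0 ∈ Set.Ioo α β) (hu : ∀ n, u (n + 1) = g (u n)) :
    (∀ n, u n ∈ Set.Ioo α β) ∧ Tendsto u atTop (𝓝 c) := by
  rcases le_total (u 0) c with h | h
  · exact tendsto_iterate_of_le hmono hcont hc hgc hlt h0.1 h hu
  -- The reflection `v ↦ -v` exchanges the two sides of the fixed point.
  have hneg : ∀ v ∈ Set.Ioo (-β) (-α), -v ∈ Set.Ioo α β := fun v hv =>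
    ⟨by linarith [hv.2], by linarith [hv.1]⟩
  obtain ⟨h1, h2⟩ := tendsto_iterate_of_le (g := fun v => -g (-v)) (α := -β) (β := -α) (c := -c)
    (u := fun n => -u n)
    (fun v hv w hw hvw => neg_le_neg (hmono (hneg w hw) (hneg v hv) (neg_le_neg hvw)))
    (hcont.comp continuousOn_neg hneg).neg
    ⟨neg_lt_neg hc.2, neg_lt_neg hc.1⟩ (by simp [hgc])
    (fun v hv => by linarith [hgt (-v) ⟨by linarith [hv.2], by linarith [hv.1]⟩])
    (neg_lt_neg h0.2) (neg_le_neg h) (fun n => by simp [hu])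
  refine ⟨fun n => ?_, ?_⟩
  · simpa using hneg _ (h1 n)
  · simpa using h2.neg

/-- If `h` and `k` have derivatives `m * b` and `b > 0` at `c`, with `0 ≤ m < l`, then `h` varies
at most `l` times as much as `k` near `c`. -/
lemma eventually_abs_sub_le_of_hasDerivAt {h k : ℝ → ℝ} {m l b : ℝ}
    (hh : HasDerivAt h (m * b) c) (hk : HasDerivAt k b c) (hb : 0 < b) (hm : 0 ≤ m)
    (hml : m < l) : ∀ᶠ v in 𝓝 c, |h v - h c| ≤ l * |k v - k c| := by
  -- The error `ε` is chosen so that `m * b + ε = l * (b - ε)`.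
  set ε := (l - m) * b / (1 + l) with hε
  have hl : 0 < 1 + l := by linarith
  have hε0 : 0 < ε := by have := sub_pos.2 hml; positivity
  have heq : m * b + ε = l * (b - ε) := by rw [hε]; field_simp; ring
  filter_upwards [hh.isLittleO.def hε0, hk.isLittleO.def hε0] with v h1 h2
  simp only [smul_eq_mul, Real.norm_eq_abs] at h1 h2
  have h3 : |h v - h c| ≤ (m * b + ε) * |v - c| := by
    calc |h v - h c| = |(h v - h c - (v - c) * (m * b)) + (v - c) * (m * b)| := by
          rw [sub_add_cancel]
      _ ≤ ε * |v - c| + |v - c| * (m * b) := by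
          refine (abs_add_le _ _).trans (add_le_add h1 ?_)
          rw [abs_mul, abs_of_nonneg (mul_nonneg hm hb.le)]
      _ = _ := by ring
  have h4 : (b - ε) * |v - c| ≤ |k v - k c| := by
    have : |(v - c) * b| ≤ |k v - k c| + |k v - k c - (v - c) * b| := by
      rw [abs_sub_comm (k v - k c), ← abs_of_nonneg (abs_nonneg (k v - k c))]
      calc |(v - c) * b| = |(k v - k c) + ((v - c) * b - (k v - k c))| := by
            rw [add_sub_cancel]
        _ ≤ _ := by rw [abs_abs]; exact abs_add_le _ _
    rw [abs_mul, abs_of_pos hb] at this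
    linarith
  calc |h v - h c| ≤ (m * b + ε) * |v - c| := h3
    _ = l * ((b - ε) * |v - c|) := by rw [heq]; ring
    _ ≤ l * |k v - k c| := mul_le_mul_of_nonneg_left h4 (hm.trans hml.le)

end Iteration

/-! ### Hilbert's metric and the log-odds -/

section Hilbert

/-- The log-odds `log (u / (1 - u))`; it identifies the open segment with the real line. -/
noncomputable def logOdds (u : ℝ) : ℝ := Real.log u - Real.log (1 - u)

lemma hasDerivAt_logOdds {u : ℝ} (hu : u ∈ Set.Ioo (0 : ℝ) 1) :
    HasDerivAt logOdds (1 / (u * (1 - u))) u := by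
  have h0 : u ≠ 0 := hu.1.ne'
  have h1 : 1 - u ≠ 0 := (sub_pos.2 hu.2).ne'
  have := (Real.hasDerivAt_log h0).sub (((hasDerivAt_id u).const_sub 1).log h1)
  convert! this using 1
  simp only [id]
  field_simp
  ring

lemma maxRatio_eq_top {d : ℕ} {x y : Fin d → ℝ} {i : Fin d} (hx : 0 < x i) (hy : y i ≤ 0) :
    maxRatio x y = ⊤ := by
  refine eq_top_iff.2 (le_trans ?_
    (le_iSup (fun i => ENNReal.ofReal (x i) / ENNReal.ofReal (y i)) i))
  rw [ENNReal.ofReal_of_nonpos hy, ENNReal.div_zero (ENNReal.ofReal_pos.2 hx).ne']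

lemma hilbertMetric_eq_top {d : ℕ} {x y : Fin d → ℝ} {i : Fin d} (hx : x i ≤ 0) (hy : 0 < y i) :
    hilbertMetric x y = ⊤ :=
  if_neg fun h => h.2 (maxRatio_eq_top hy hx)

lemma maxRatio_fin_two {x y : Fin 2 → ℝ} (hy : ∀ i, 0 < y i) :
    maxRatio x y = ENNReal.ofReal (max (x 0 / y 0) (x 1 / y 1)) := by
  have h : ∀ i, ENNReal.ofReal (x i) / ENNReal.ofReal (y i) = ENNReal.ofReal (x i / y i) :=
    fun i => (ENNReal.ofReal_div_of_pos (hy i)).symm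
  simp only [maxRatio, h]
  rw [ENNReal.ofReal_max]
  refine le_antisymm (iSup_le fun i => ?_) (sup_le ?_ ?_)
  · fin_cases i
    · exact le_max_left _ _
    · exact le_max_right _ _
  · exact le_iSup (fun i => ENNReal.ofReal (x i / y i)) 0
  · exact le_iSup (fun i => ENNReal.ofReal (x i / y i)) 1

/-- On the relative interior of the segment, Hilbert's metric is the distance of the log-odds. -/
lemma hilbertMetric_eq_abs_logOdds {x y : Fin 2 → ℝ} (hx : ∀ i, 0 < x i) (hy : ∀ i, 0 < y i)
    (hx1 : x 1 = 1 - x 0) (hy1 : y 1 = 1 - y 0) :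
    hilbertMetric x y = ((|logOdds (x 0) - logOdds (y 0)| : ℝ) : EReal) := by
  rw [hilbertMetric, maxRatio_fin_two hy, maxRatio_fin_two hx,
    if_pos ⟨ENNReal.ofReal_ne_top, ENNReal.ofReal_ne_top⟩]
  congr 1
  simp only [logOdds, ← hx1, ← hy1]
  have hx0 := hx 0; have hx1' := hx 1; have hy0 := hy 0; have hy1' := hy 1
  rw [ENNReal.toReal_mul, ENNReal.toReal_ofReal (by positivity),
    ENNReal.toReal_ofReal (by positivity)]
  have hl : ∀ {p q r s : ℝ}, 0 < p → 0 < q → 0 < r → 0 < s →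
      Real.log (p / q * (r / s)) = Real.log p - Real.log q + (Real.log r - Real.log s) := by
    intro p q r s hp hq hr hs
    rw [Real.log_mul (by positivity) (by positivity), Real.log_div hp.ne' hq.ne',
      Real.log_div hr.ne' hs.ne']
  rcases le_total (x 0 / y 0) (x 1 / y 1) with h | h
  · have h' : y 1 / x 1 ≤ y 0 / x 0 := by
      rw [div_le_div_iff₀ (by assumption) (by assumption)] at h ⊢
      linarith
    have hlog := Real.log_le_log (by positivity) h
    rw [Real.log_div hx0.ne' hy0.ne', Real.log_div hx1'.ne' hy1'.ne'] at hlog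
    rw [max_eq_right h, max_eq_left h', hl hx1' hy1' hy0 hx0, abs_of_nonpos (by linarith)]
    ring
  · have h' : y 0 / x 0 ≤ y 1 / x 1 := by
      rw [div_le_div_iff₀ (by assumption) (by assumption)] at h ⊢
      linarith
    have hlog := Real.log_le_log (by positivity) h
    rw [Real.log_div hx0.ne' hy0.ne', Real.log_div hx1'.ne' hy1'.ne'] at hlog
    rw [max_eq_left h, max_eq_right h', hl hx0 hy0 hy1' hx1', abs_of_nonneg (by linarith)]
    ring

end Hilbert

/-! ### The iteration on the segment -/

section Segment

lemma pos_of_mem_intrinsicInterior_stdSimplex {x : Fin 2 → ℝ}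
    (hx : x ∈ intrinsicInterior ℝ (stdSimplex ℝ (Fin 2))) : ∀ i, 0 < x i := by
  have hxS := intrinsicInterior_subset hx
  have hsum : x 0 + x 1 = 1 := by simpa [Fin.sum_univ_two] using hxS.2
  obtain ⟨y, hy, hyx⟩ := mem_intrinsicInterior.1 hx
  -- The segment is parametrized by an affine line in its affine span.
  let e : Fin 2 → Fin 2 → ℝ := fun i => Pi.single i 1
  have he : ∀ i, e i ∈ affineSpan ℝ (stdSimplex ℝ (Fin 2)) := fun i =>
    subset_affineSpan ℝ _ (single_mem_stdSimplex ℝ i)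
  let c : ℝ → affineSpan ℝ (stdSimplex ℝ (Fin 2)) := fun t =>
    ⟨AffineMap.lineMap (e 0) (e 1) t, AffineMap.lineMap_mem t (he 0) (he 1)⟩
  have hc : Continuous c := Continuous.subtype_mk AffineMap.lineMap_continuous _
  have hval : ∀ t, (c t : Fin 2 → ℝ) = ![1 - t, t] := by
    intro t
    ext i
    fin_cases i
    · simp [c, e, AffineMap.lineMap_apply]
      ring
    · simp [c, e, AffineMap.lineMap_apply]
  have hct : c (x 1) = y := by
    apply Subtype.ext
    rw [hval, hyx]
    ext i
    fin_cases i
    · simp; linarith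
    · simp
  have hmem : x 1 ∈ interior (Set.Icc (0 : ℝ) 1) := by
    rw [mem_interior_iff_mem_nhds]
    have := hc.continuousAt.preimage_mem_nhds (hct ▸ mem_interior_iff_mem_nhds.1 hy)
    refine mem_of_superset this fun t ht => ?_
    have ht' : (c t : Fin 2 → ℝ) ∈ stdSimplex ℝ (Fin 2) := ht
    rw [hval] at ht'
    have h0 := ht'.1 0
    have h1 := ht'.1 1
    simp at h0 h1
    exact ⟨h1, h0⟩
  rw [interior_Icc] at hmem
  intro i
  fin_cases i
  · show 0 < x 0
    linarith [hmem.2]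
  · exact hmem.1

lemma pos_segment {u : ℝ} (hu : u ∈ Set.Ioo (0 : ℝ) 1) : ∀ i, 0 < (![u, 1 - u] : Fin 2 → ℝ) i := by
  intro i
  fin_cases i
  · exact hu.1
  · exact sub_pos.2 hu.2

lemma dotProduct_segment (w : Fin 2 → ℝ) (u : ℝ) :
    w ⬝ᵥ ![u, 1 - u] = w 0 * u + w 1 * (1 - u) := by
  simp [dotProduct, Fin.sum_univ_two]

variable {Ω : Type*} [MeasurableSpace Ω] {P : Measure Ω} {a : Ω → Fin 2 → ℝ}

/-- Equality of the two coordinates almost surely would make the ratio constantly `1`. -/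
lemma not_ae_eq_of_ratio_not_const (ha_val : ∀ᵐ ω ∂P, (∀ i, 0 ≤ a ω i) ∧ a ω ≠ 0)
    (ha_ratio : ¬ ∃ c : ℝ≥0∞, ∀ᵐ ω ∂P,
      ENNReal.ofReal (a ω 0) / ENNReal.ofReal (a ω 1) = c) :
    ¬ ∀ᵐ ω ∂P, a ω 0 = a ω 1 := by
  refine fun h => ha_ratio ⟨1, ?_⟩
  filter_upwards [ha_val, h] with ω hω h
  have h1 : 0 < a ω 1 := by
    refine (hω.1 1).lt_of_ne' fun h1 => hω.2 ?_
    ext i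
    fin_cases i
    · exact h.trans h1
    · exact h1
  rw [h]
  exact ENNReal.div_self (ENNReal.ofReal_pos.2 h1).ne' ENNReal.ofReal_ne_top

variable [IsProbabilityMeasure P]

lemma sum_mul_integral_div_eq_one {d : ℕ} {a : Ω → Fin d → ℝ} (ha : Measurable a)
    (ha_val : ∀ᵐ ω ∂P, (∀ i, 0 ≤ a ω i) ∧ a ω ≠ 0) {x : Fin d → ℝ} (hx : ∀ i, 0 < x i) :
    ∑ i, x i * ∫ ω, a ω i / (a ω ⬝ᵥ x) ∂P = 1 := by
  simp only [← integral_const_mul]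
  rw [← integral_finsetSum _ fun i _ => (integrable_div_dotProduct ha ha_val hx i).const_mul _]
  have h : ∀ᵐ ω ∂P, ∑ i, x i * (a ω i / (a ω ⬝ᵥ x)) = 1 := by
    filter_upwards [ha_val] with ω hω
    have : ∀ i, x i * (a ω i / (a ω ⬝ᵥ x)) = a ω i * x i / (a ω ⬝ᵥ x) := fun i => by ring
    simp only [this]
    rw [← Finset.sum_div]
    exact div_self (dotProduct_pos_of_ne_zero hω.1 hω.2 hx).ne'
  rw [integral_congr_ae h]
  simp

lemma integrable_div_mul_div {d : ℕ} {a : Ω → Fin d → ℝ} (ha : Measurable a)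
    (ha_val : ∀ᵐ ω ∂P, (∀ i, 0 ≤ a ω i) ∧ a ω ≠ 0) {x y : Fin d → ℝ} (hx : ∀ i, 0 < x i)
    (hy : ∀ i, 0 < y i) (i j : Fin d) :
    Integrable (fun ω => a ω i / (a ω ⬝ᵥ x) * (a ω j / (a ω ⬝ᵥ y))) P := by
  refine (integrable_div_dotProduct ha ha_val hy j).bdd_mul (c := 1 / x i)
    (integrable_div_dotProduct ha ha_val hx i).aestronglyMeasurable ?_
  filter_upwards [ha_val] with ω hω
  exact abs_div_dotProduct_le hω.1 hω.2 hx i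

lemma integrable_sq_sub_div (ha : Measurable a)
    (ha_val : ∀ᵐ ω ∂P, (∀ i, 0 ≤ a ω i) ∧ a ω ≠ 0) {x y : Fin 2 → ℝ} (hx : ∀ i, 0 < x i)
    (hy : ∀ i, 0 < y i) :
    Integrable (fun ω => (a ω 0 - a ω 1) ^ 2 / ((a ω ⬝ᵥ x) * (a ω ⬝ᵥ y))) P := by
  have h := integrable_div_mul_div ha ha_val hx hy
  refine (((h 0 0).sub (h 0 1)).sub ((h 1 0).sub (h 1 1))).congr (ae_of_all _ fun ω => ?_)
  simp only [Pi.sub_apply]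
  ring

lemma integral_sq_sub_div_pos (ha : Measurable a)
    (ha_val : ∀ᵐ ω ∂P, (∀ i, 0 ≤ a ω i) ∧ a ω ≠ 0) (hne : ¬ ∀ᵐ ω ∂P, a ω 0 = a ω 1)
    {x y : Fin 2 → ℝ} (hx : ∀ i, 0 < x i) (hy : ∀ i, 0 < y i) :
    0 < ∫ ω, (a ω 0 - a ω 1) ^ 2 / ((a ω ⬝ᵥ x) * (a ω ⬝ᵥ y)) ∂P := by
  have hnn : 0 ≤ᵐ[P] fun ω => (a ω 0 - a ω 1) ^ 2 / ((a ω ⬝ᵥ x) * (a ω ⬝ᵥ y)) := by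
    filter_upwards [ha_val] with ω hω
    have h1 := dotProduct_pos_of_ne_zero hω.1 hω.2 hx
    have h2 := dotProduct_pos_of_ne_zero hω.1 hω.2 hy
    simp only [Pi.zero_apply]
    positivity
  refine (integral_nonneg_of_ae hnn).lt_of_ne' fun h0 => hne ?_
  rw [integral_eq_zero_iff_of_nonneg_ae hnn (integrable_sq_sub_div ha ha_val hx hy)] at h0
  filter_upwards [h0, ha_val] with ω h0 hω
  have h1 := dotProduct_pos_of_ne_zero hω.1 hω.2 hx
  have h2 := dotProduct_pos_of_ne_zero hω.1 hω.2 hy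
  rw [Pi.zero_apply, div_eq_zero_iff, or_iff_left (mul_pos h1 h2).ne', sq_eq_zero_iff,
    sub_eq_zero] at h0
  exact h0

/-- The first-order optimality condition: the directional derivative of the objective along the
segment vanishes at an interior minimizer. -/
lemma integral_div_eq_of_isMinOn (ha : Measurable a)
    (ha_val : ∀ᵐ ω ∂P, (∀ i, 0 ≤ a ω i) ∧ a ω ≠ 0) {x : Fin 2 → ℝ} (hx : ∀ i, 0 < x i)
    (hx1 : x 0 + x 1 = 1) (hint : Integrable (fun ω => Real.log (a ω ⬝ᵥ x)) P)
    (hmin : IsMinOn (objective P a) (stdSimplex ℝ (Fin 2)) x) :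
    ∫ ω, a ω 0 / (a ω ⬝ᵥ x) ∂P = ∫ ω, a ω 1 / (a ω ⬝ᵥ x) ∂P := by
  have hder := hasLineDerivAt_realObjective ha ha_val hx hint ![1, -1]
  have hloc : IsLocalMin (fun t : ℝ => realObjective P a (x + t • ![1, -1])) 0 := by
    filter_upwards [(tendsto_line x ![1, -1]).eventually (eventually_pos hx)] with t ht
    simp only [zero_smul, add_zero]
    have hle : objective P a x ≤ objective P a (x + t • ![1, -1]) := by
      refine hmin ⟨fun i => (ht i).le, ?_⟩
      simp [Fin.sum_univ_two]
      linarith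
    rw [objective_eq_integral ha_val hx hint, objective_eq_integral ha_val ht
      (integrable_log_of_integrable_log ha ha_val hx hint ht), EReal.coe_le_coe_iff] at hle
    rwa [realObjective_eq_integral ha_val hx hint, realObjective_eq_integral ha_val ht
      (integrable_log_of_integrable_log ha ha_val hx hint ht)]
  have h0 := hloc.hasDerivAt_eq_zero hder
  have hv : ∀ ω, (a ω ⬝ᵥ ![1, -1]) / (a ω ⬝ᵥ x) =
      a ω 0 / (a ω ⬝ᵥ x) - a ω 1 / (a ω ⬝ᵥ x) := by
    intro ω
    rw [← sub_div]
    simp [dotProduct, Fin.sum_univ_two, sub_eq_add_neg]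
  simp only [hv] at h0
  rw [integral_sub (integrable_div_dotProduct ha ha_val hx 0)
    (integrable_div_dotProduct ha ha_val hx 1)] at h0
  linarith

/-- The operator `S` on the open segment, in the coordinate `u ↦ (u, 1 - u)`. -/
noncomputable def segmentMap (P : Measure Ω) (a : Ω → Fin 2 → ℝ) (u : ℝ) : ℝ :=
  u * ∫ ω, a ω 0 / (a ω ⬝ᵥ ![u, 1 - u]) ∂P

lemma fixedPointOperator_segment (ha : Measurable a)
    (ha_val : ∀ᵐ ω ∂P, (∀ i, 0 ≤ a ω i) ∧ a ω ≠ 0) {u : ℝ} (hu : u ∈ Set.Ioo (0 : ℝ) 1)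
    (hint : Integrable (fun ω => Real.log (a ω ⬝ᵥ ![u, 1 - u])) P) :
    fixedPointOperator P a ![u, 1 - u] = ![segmentMap P a u, 1 - segmentMap P a u] := by
  have hsum := sum_mul_integral_div_eq_one ha ha_val (pos_segment hu)
  rw [Fin.sum_univ_two] at hsum
  ext i
  rw [fixedPointOperator_eq ha ha_val (pos_segment hu) hint]
  fin_cases i
  · rfl
  · exact eq_sub_of_add_eq' hsum

lemma monotoneOn_segmentMap (ha : Measurable a)
    (ha_val : ∀ᵐ ω ∂P, (∀ i, 0 ≤ a ω i) ∧ a ω ≠ 0) :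
    MonotoneOn (segmentMap P a) (Set.Ioo 0 1) := by
  intro u hu v hv huv
  simp only [segmentMap, ← integral_const_mul]
  refine integral_mono_ae ((integrable_div_dotProduct ha ha_val (pos_segment hu) 0).const_mul _)
    ((integrable_div_dotProduct ha ha_val (pos_segment hv) 0).const_mul _) ?_
  filter_upwards [ha_val] with ω hω
  have hDu := dotProduct_pos_of_ne_zero hω.1 hω.2 (pos_segment hu)
  have hDv := dotProduct_pos_of_ne_zero hω.1 hω.2 (pos_segment hv)
  rw [← mul_div_assoc, ← mul_div_assoc, div_le_div_iff₀ hDu hDv, dotProduct_segment,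
    dotProduct_segment]
  have := mul_nonneg (mul_nonneg (hω.1 0) (hω.1 1)) (sub_nonneg.2 huv)
  linarith

/-- The derivative of the operator along the segment is the mixed second derivative
`𝔼[a(0) a(1) / ⟨a, x⟩²]` of the objective. -/
lemma hasDerivAt_segmentMap (ha : Measurable a)
    (ha_val : ∀ᵐ ω ∂P, (∀ i, 0 ≤ a ω i) ∧ a ω ≠ 0) {u : ℝ} (hu : u ∈ Set.Ioo (0 : ℝ) 1) :
    HasDerivAt (segmentMap P a)
      (∫ ω, a ω 0 * a ω 1 / (a ω ⬝ᵥ ![u, 1 - u]) ^ 2 ∂P) u := by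
  have hx := pos_segment hu
  obtain ⟨hI, hline⟩ := hasLineDerivAt_integral_div ha ha_val hx 0 ![1, -1]
  have hshift : HasDerivAt (fun v : ℝ => ∫ ω, a ω 0 / (a ω ⬝ᵥ ![v, 1 - v]) ∂P)
      (-∫ ω, a ω 0 * (a ω ⬝ᵥ ![1, -1]) / (a ω ⬝ᵥ ![u, 1 - u]) ^ 2 ∂P) u := by
    have h0 : HasDerivAt (fun t : ℝ => ∫ ω, a ω 0 / (a ω ⬝ᵥ (![u, 1 - u] + t • ![1, -1])) ∂P)
      (-∫ ω, a ω 0 * (a ω ⬝ᵥ ![1, -1]) / (a ω ⬝ᵥ ![u, 1 - u]) ^ 2 ∂P) (u - u) := by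
      rw [sub_self]; exact hline
    have h1 := h0.comp_sub_const u u
    refine h1.congr_of_eventuallyEq (Eventually.of_forall fun v => ?_)
    have : (![u, 1 - u] + (v - u) • ![1, -1] : Fin 2 → ℝ) = ![v, 1 - v] := by
      ext i
      fin_cases i <;> simp
    simp only [this]
  have h := (hasDerivAt_id u).mul hshift
  convert! h using 1
  simp only [id, one_mul]
  rw [← integral_neg, ← integral_const_mul,
    ← integral_add (integrable_div_dotProduct ha ha_val hx 0) (hI.fun_neg.const_mul u)]
  refine integral_congr_ae ?_
  filter_upwards [ha_val] with ω hω
  have hD := (dotProduct_pos_of_ne_zero hω.1 hω.2 hx).ne'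
  have hv : a ω ⬝ᵥ ![1, -1] = a ω 0 - a ω 1 := by
    simp [dotProduct, Fin.sum_univ_two, sub_eq_add_neg]
  rw [hv]
  field_simp
  rw [dotProduct_segment]
  ring

/-- The operator moves `u` towards a stationary point `c`. -/
lemma segmentMap_eq (ha : Measurable a)
    (ha_val : ∀ᵐ ω ∂P, (∀ i, 0 ≤ a ω i) ∧ a ω ≠ 0) {u c : ℝ} (hu : u ∈ Set.Ioo (0 : ℝ) 1)
    (hc : c ∈ Set.Ioo (0 : ℝ) 1)
    (hopt : ∫ ω, a ω 0 / (a ω ⬝ᵥ ![c, 1 - c]) ∂P = ∫ ω, a ω 1 / (a ω ⬝ᵥ ![c, 1 - c]) ∂P) :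
    segmentMap P a u = u + u * (1 - u) * (c - u) *
      ∫ ω, (a ω 0 - a ω 1) ^ 2 / ((a ω ⬝ᵥ ![u, 1 - u]) * (a ω ⬝ᵥ ![c, 1 - c])) ∂P := by
  have hi := integrable_div_dotProduct ha ha_val (pos_segment hu)
  have hj := integrable_div_dotProduct ha ha_val (pos_segment hc)
  have hsum := sum_mul_integral_div_eq_one ha ha_val (pos_segment hu)
  rw [Fin.sum_univ_two] at hsum
  simp only [Matrix.cons_val_zero, Matrix.cons_val_one] at hsum
  have hdiff : (∫ ω, a ω 0 / (a ω ⬝ᵥ ![u, 1 - u]) ∂P) - ∫ ω, a ω 1 / (a ω ⬝ᵥ ![u, 1 - u]) ∂P =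
      (c - u) * ∫ ω, (a ω 0 - a ω 1) ^ 2 /
        ((a ω ⬝ᵥ ![u, 1 - u]) * (a ω ⬝ᵥ ![c, 1 - c])) ∂P := by
    have hi' : Integrable (fun ω => a ω 0 / (a ω ⬝ᵥ ![u, 1 - u]) - a ω 1 / (a ω ⬝ᵥ ![u, 1 - u])) P :=
      (hi 0).sub (hi 1)
    have hj' : Integrable (fun ω => a ω 0 / (a ω ⬝ᵥ ![c, 1 - c]) - a ω 1 / (a ω ⬝ᵥ ![c, 1 - c])) P :=
      (hj 0).sub (hj 1)
    rw [← sub_zero (_ - _ : ℝ), ← sub_eq_zero.2 hopt, ← integral_sub (hi 0) (hi 1),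
      ← integral_sub (hj 0) (hj 1), ← integral_sub hi' hj',
      ← integral_const_mul]
    refine integral_congr_ae ?_
    filter_upwards [ha_val] with ω hω
    have hDu := (dotProduct_pos_of_ne_zero hω.1 hω.2 (pos_segment hu)).ne'
    have hDc := (dotProduct_pos_of_ne_zero hω.1 hω.2 (pos_segment hc)).ne'
    field_simp
    rw [dotProduct_segment, dotProduct_segment]
    ring
  rw [segmentMap]
  linear_combination u * hsum + u * (1 - u) * hdiff

/-- At a stationary point, `1 - 𝔼[a(0) a(1) / ⟨a, x⟩²]` is `c (1 - c)` times the second moment of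
`(a(0) - a(1)) / ⟨a, x⟩`. -/
lemma one_sub_integral_mul_div_sq (ha : Measurable a)
    (ha_val : ∀ᵐ ω ∂P, (∀ i, 0 ≤ a ω i) ∧ a ω ≠ 0) {c : ℝ} (hc : c ∈ Set.Ioo (0 : ℝ) 1)
    (hopt : ∫ ω, a ω 0 / (a ω ⬝ᵥ ![c, 1 - c]) ∂P = ∫ ω, a ω 1 / (a ω ⬝ᵥ ![c, 1 - c]) ∂P) :
    1 - ∫ ω, a ω 0 * a ω 1 / (a ω ⬝ᵥ ![c, 1 - c]) ^ 2 ∂P = c * (1 - c) *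
      ∫ ω, (a ω 0 - a ω 1) ^ 2 / ((a ω ⬝ᵥ ![c, 1 - c]) * (a ω ⬝ᵥ ![c, 1 - c])) ∂P := by
  have hx := pos_segment hc
  have hi := integrable_div_dotProduct ha ha_val hx
  have hsum := sum_mul_integral_div_eq_one ha ha_val hx
  rw [Fin.sum_univ_two] at hsum
  simp only [Matrix.cons_val_zero, Matrix.cons_val_one] at hsum
  have hone : 1 = ∫ ω, ((1 - c) * (a ω 0 / (a ω ⬝ᵥ ![c, 1 - c])) +
      c * (a ω 1 / (a ω ⬝ᵥ ![c, 1 - c]))) ∂P := by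
    rw [integral_add ((hi 0).const_mul _) ((hi 1).const_mul _), integral_const_mul,
      integral_const_mul]
    linear_combination -hsum + (2 * c - 1) * hopt
  have hI : Integrable (fun ω => a ω 0 * a ω 1 / (a ω ⬝ᵥ ![c, 1 - c]) ^ 2) P :=
    (integrable_div_mul_div ha ha_val hx hx 0 1).congr (ae_of_all _ fun ω => by
      simp only [div_mul_div_comm, sq])
  nth_rewrite 1 [hone]
  rw [← integral_sub (((hi 0).const_mul _).fun_add ((hi 1).const_mul _)) hI, ← integral_const_mul]
  refine integral_congr_ae ?_
  filter_upwards [ha_val] with ω hω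
  have hD := (dotProduct_pos_of_ne_zero hω.1 hω.2 hx).ne'
  field_simp
  rw [dotProduct_segment]
  ring

end Segment

end LogOptimal

theorem mainTheorem3 {Ω : Type*} [MeasurableSpace Ω] (P : Measure Ω) [IsProbabilityMeasure P]
    (a : Ω → Fin 2 → ℝ) (ha : Measurable a)
    (ha_val : ∀ᵐ ω ∂P, (∀ i, 0 ≤ a ω i) ∧ a ω ≠ 0)
    (ha_ratio : ¬ ∃ c : ℝ≥0∞, ∀ᵐ ω ∂P,
      ENNReal.ofReal (a ω 0) / ENNReal.ofReal (a ω 1) = c)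
    (xs : Fin 2 → ℝ)
    (hxs_min : IsMinOn (LogOptimal.objective P a) (stdSimplex ℝ (Fin 2)) xs)
    (hxs_fin : LogOptimal.objective P a xs ≠ ⊤ ∧ LogOptimal.objective P a xs ≠ ⊥)
    (hxs_int : xs ∈ intrinsicInterior ℝ (stdSimplex ℝ (Fin 2))) :
    -- the objective is finite with first partial derivatives near the minimizer, and has
    -- second partial derivatives at the minimizer
    (∀ᶠ y in 𝓝 xs, LogOptimal.objective P a y ≠ ⊤ ∧ LogOptimal.objective P a y ≠ ⊥ ∧
      ∀ i, LineDifferentiableAt ℝ (LogOptimal.realObjective P a) y (Pi.single i 1)) ∧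
    (∀ i j, LineDifferentiableAt ℝ
      (LogOptimal.partialDeriv j (LogOptimal.realObjective P a)) xs (Pi.single i 1)) ∧
    LogOptimal.maxOffDiagHessian P a xs = LogOptimal.hessian P a xs 0 1 ∧
    LogOptimal.maxOffDiagHessian P a xs < 1 ∧
    ∀ x : ℕ → Fin 2 → ℝ, x 1 ∈ stdSimplex ℝ (Fin 2) →
      (∀ t, 1 ≤ t → x (t + 1) = LogOptimal.fixedPointOperator P a (x t)) →
      ∀ L' ∈ Set.Ioo (LogOptimal.maxOffDiagHessian P a xs) 1,
        ∃ T : ℕ, 1 ≤ T ∧ ∀ t, T ≤ t →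
          LogOptimal.hilbertMetric (x (t + 1)) xs ≤
            (L' : EReal) * LogOptimal.hilbertMetric (x t) xs := by
  open LogOptimal in
  have hpos := pos_of_mem_intrinsicInterior_stdSimplex hxs_int
  have hxs_sum : xs 0 + xs 1 = 1 := by
    simpa [Fin.sum_univ_two] using (intrinsicInterior_subset hxs_int).2
  have hint := integrable_log_of_objective_finite ha ha_val hpos hxs_fin
  have hint' : ∀ y : Fin 2 → ℝ, (∀ i, 0 < y i) →
      Integrable (fun ω => Real.log (a ω ⬝ᵥ y)) P := fun y hy =>
    integrable_log_of_integrable_log ha ha_val hpos hint hy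
  have hne := not_ae_eq_of_ratio_not_const ha_val ha_ratio
  obtain ⟨c, hc⟩ : ∃ c, c = xs 0 := ⟨_, rfl⟩
  have hcI : c ∈ Set.Ioo (0 : ℝ) 1 := ⟨hc ▸ hpos 0, by linarith [hpos 1]⟩
  have hxs : xs = ![c, 1 - c] := by
    ext i
    fin_cases i
    · exact hc.symm
    · show xs 1 = 1 - c
      linarith
  have hopt := integral_div_eq_of_isMinOn ha ha_val hpos hxs_sum hint hxs_min
  have hH : ∀ i j, hessian P a xs i j = ∫ ω, a ω j * a ω i / (a ω ⬝ᵥ xs) ^ 2 ∂P :=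
    hessian_eq_integral ha ha_val hpos hint
  have hsymm : hessian P a xs 1 0 = hessian P a xs 0 1 := by
    simp only [hH, mul_comm]
  have hmax : maxOffDiagHessian P a xs = hessian P a xs 0 1 := by
    have h : ∀ p : {p : Fin 2 × Fin 2 // p.1 ≠ p.2},
        hessian P a xs p.1.1 p.1.2 = hessian P a xs 0 1 := by
      rintro ⟨⟨i, j⟩, hij⟩
      fin_cases i <;> fin_cases j
      · exact absurd rfl hij
      · rfl
      · exact hsymm
      · exact absurd rfl hij
    have : Nonempty {p : Fin 2 × Fin 2 // p.1 ≠ p.2} := ⟨⟨(0, 1), by decide⟩⟩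
    rw [maxOffDiagHessian, iSup_congr h, ciSup_const]
  have hL : maxOffDiagHessian P a xs =
      ∫ ω, a ω 0 * a ω 1 / (a ω ⬝ᵥ ![c, 1 - c]) ^ 2 ∂P := by
    rw [hmax, ← hsymm, hH, hxs]
  have hL0 : 0 ≤ maxOffDiagHessian P a xs := by
    rw [hL]
    refine integral_nonneg_of_ae ?_
    filter_upwards [ha_val] with ω hω
    exact div_nonneg (mul_nonneg (hω.1 0) (hω.1 1)) (sq_nonneg _)
  rw [hxs] at hopt
  have hL1 : maxOffDiagHessian P a xs < 1 := by
    have h := one_sub_integral_mul_div_sq ha ha_val hcI hopt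
    have h2 := integral_sq_sub_div_pos ha ha_val hne (pos_segment hcI) (pos_segment hcI)
    rw [← hL] at h
    have := mul_pos (mul_pos hcI.1 (sub_pos.2 hcI.2)) h2
    linarith
  refine ⟨?_, fun i j => (hasLineDerivAt_partialDeriv ha ha_val hpos hint i j).lineDifferentiableAt,
    hmax, hL1, ?_⟩
  · filter_upwards [eventually_pos hpos] with y hy
    rw [objective_eq_integral ha_val hy (hint' y hy)]
    exact ⟨EReal.coe_ne_top _, EReal.coe_ne_bot _, fun i =>
      (hasLineDerivAt_realObjective ha ha_val hy (hint' y hy) _).lineDifferentiableAt⟩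
  intro x hx1 hx L' hL'
  have hL'0 : 0 < L' := hL0.trans_lt hL'.1
  by_cases hx1pos : ∀ i, 0 < x 1 i
  swap
  · -- A vanishing coordinate stays zero, and then both distances are infinite.
    obtain ⟨i, hi⟩ := not_forall.1 hx1pos
    have hzero : ∀ t, 1 ≤ t → x t i = 0 := by
      intro t ht
      induction t, ht using Nat.le_induction with
      | base => exact le_antisymm (not_lt.1 hi) (hx1.1 i)
      | succ t ht ih => rw [hx t ht, fixedPointOperator, ih, zero_mul]
    refine ⟨1, le_rfl, fun t ht => ?_⟩
    rw [hilbertMetric_eq_top (hzero t ht).le (hpos i), EReal.coe_mul_top_of_pos hL'0]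
    exact le_top
  have hx1sum : x 1 0 + x 1 1 = 1 := by simpa [Fin.sum_univ_two] using hx1.2
  have hfixed : segmentMap P a c = c := by
    simpa using segmentMap_eq ha ha_val hcI hcI hopt
  have hdrift : ∀ v ∈ Set.Ioo (0 : ℝ) 1, ∃ k > 0, segmentMap P a v = v + k * (c - v) := by
    intro v hv
    refine ⟨_, mul_pos (mul_pos hv.1 (sub_pos.2 hv.2))
      (integral_sq_sub_div_pos ha ha_val hne (pos_segment hv) (pos_segment hcI)), ?_⟩
    rw [segmentMap_eq ha ha_val hv hcI hopt]
    ring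
  -- The sequence `x` starts at index `1`, its coordinate sequence `u` at index `0`.
  let u : ℕ → ℝ := fun n => Nat.rec (x 1 0) (fun _ v => segmentMap P a v) n
  have hu : ∀ n, u (n + 1) = segmentMap P a (u n) := fun _ => rfl
  obtain ⟨hmem, hlim⟩ := tendsto_iterate (monotoneOn_segmentMap ha ha_val)
    (fun v hv => (hasDerivAt_segmentMap ha ha_val hv).continuousAt.continuousWithinAt) hcI hfixed
    (fun v hv => by
      obtain ⟨k, hk, h⟩ := hdrift v ⟨hv.1, hv.2.trans hcI.2⟩
      have := mul_pos hk (sub_pos.2 hv.2)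
      linarith)
    (fun v hv => by
      obtain ⟨k, hk, h⟩ := hdrift v ⟨hcI.1.trans hv.1, hv.2⟩
      have := mul_pos hk (sub_pos.2 hv.1)
      linarith)
    (u := u) ⟨hx1pos 0, by show x 1 0 < 1; linarith [hx1pos 1]⟩ hu
  have hxu : ∀ n, x (n + 1) = ![u n, 1 - u n] := by
    intro n
    induction n with
    | zero =>
      ext i
      fin_cases i
      · rfl
      · exact eq_sub_of_add_eq' hx1sum
    | succ n ih =>
      rw [hx (n + 1) (Nat.le_add_left 1 n), ih, fixedPointOperator_segment ha ha_val (hmem n)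
        (hint' _ (pos_segment (hmem n))), hu]
  have hdist : ∀ n, hilbertMetric (x (n + 1)) xs = ((|logOdds (u n) - logOdds c| : ℝ) : EReal) := by
    intro n
    rw [hxu n, hxs]
    exact hilbertMetric_eq_abs_logOdds (pos_segment (hmem n)) (pos_segment hcI) rfl rfl
  have hlo := hasDerivAt_logOdds hcI
  have hcomp : HasDerivAt (fun v => logOdds (segmentMap P a v))
      (maxOffDiagHessian P a xs * (1 / (c * (1 - c)))) c := by
    have h := hasDerivAt_segmentMap ha ha_val hcI
    rw [← hL] at h
    rw [mul_comm]
    exact HasDerivAt.comp c (by rw [hfixed]; exact hlo) h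
  have hev := eventually_abs_sub_le_of_hasDerivAt hcomp hlo
    (one_div_pos.2 (mul_pos hcI.1 (sub_pos.2 hcI.2))) hL0 hL'.1
  obtain ⟨N, hN⟩ := eventually_atTop.1 (hlim.eventually hev)
  refine ⟨N + 1, Nat.le_add_left 1 N, fun t ht => ?_⟩
  obtain ⟨n, rfl⟩ := Nat.exists_eq_add_of_le' ((Nat.le_add_left 1 N).trans ht)
  have h := hN n (Nat.le_of_succ_le_succ ht)
  rw [hdist, hdist, ← EReal.coe_mul, EReal.coe_le_coe_iff, hu]
  rwa [hfixed] at h
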